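/- Let $d\ge 1$, let $S_d^{++}$ denote the set of real symmetric positive-definite $d\times d$ matrices, let $\varepsilon>0$, $A,B\in S_d^{++}$, $\Sigma\in S_{2d}^{++}$, and let $\mu=N_d(A)$, $\nu=N_d(B)$ be the centered Gaussian measures on $\mathbb R^d$ with covariance matrices $A$ and $B$. Define $$W_\Sigma^\varepsilon(\mu,\nu)=\inf_{\pi\in\Pi(\mu,\nu)}\int_{\mathbb R^d\times\mathbb R^d}\|x-y\|^2\,d\pi(x,y)+2\varepsilon\,\mathrm{KL}\big(\pi\,|\,N_{2d}(\Sigma)\big),$$ where $\Pi(\mu,\nu)$ is the set of couplings of $\mu$ and $\nu$, $N_{2d}(\Sigma)$ is the centered Gaussian measure on $\mathbb R^d\times\mathbb R^d$ with covariance matrix $\Sigma$, and $\mathrm{KL}$ is the Kullback–Leibler divergence. Write $\Gamma=\Sigma^{-1}=\begin{pmatrix}\Gamma_{11}&\Gamma_{12}\\ \Gamma_{12}^T&\Gamma_{22}\end{pmatrix}$ with $d\times d$ blocks, $M_\varepsilon=I_d-\varepsilon\Gamma_{12}$, and $\langle X,Y\rangle=\mathrm{tr}(XY^T)$. Here $\log\det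 X$ is understood as the extended log-determinant, equal to $-\infty$ when the symmetric matrix $X$ is not positive-definite. Then $$W_\Sigma^\varepsilon(\mu,\nu)=\max_{(F,G)\in S_d^{++}\times S_d^{++}}\ \langle I_d+\varepsilon\Gamma_{11}-F,A\rangle+\langle I_d+\varepsilon\Gamma_{22}-G,B\rangle+\varepsilon\log\det\begin{pmatrix}F&-M_\varepsilon\\-M_\varepsilon^T&G\end{pmatrix}-\varepsilon\log\det(\varepsilon\Sigma^{-1}),$$ and in particular the maximum is attained. -/

import Mathlib

open MeasureTheory ProbabilityTheory InformationTheory Matrix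
open scoped ENNReal

namespace GaussianEOT

/-- The set `Π(μ, ν)` of couplings of `μ` and `ν`: measures on the product space with first
marginal `μ` and second marginal `ν`. -/
def couplings {E F : Type*} [MeasurableSpace E] [MeasurableSpace F]
    (μ : Measure E) (ν : Measure F) : Set (Measure (E × F)) :=
  {π | π.fst = μ ∧ π.snd = ν}

/-- The objective `∫ ‖x - y‖² dπ(x, y) + 2 ε KL(π | πref)`, with values in `[0, ∞]`. -/
noncomputable def objective {E : Type*} [NormedAddCommGroup E] [MeasurableSpace E]
    (ε : ℝ) (πref π : Measure (E × E)) : ℝ≥0∞ :=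
  (∫⁻ p, ENNReal.ofReal (‖p.1 - p.2‖ ^ 2) ∂π) + ENNReal.ofReal (2 * ε) * klDiv π πref

/-- The entropic optimal transport value: the infimum of the objective over all couplings. -/
noncomputable def value {E : Type*} [NormedAddCommGroup E] [MeasurableSpace E]
    (ε : ℝ) (πref : Measure (E × E)) (μ ν : Measure E) : ℝ≥0∞ :=
  ⨅ π ∈ couplings μ ν, objective ε πref π

/-- The centered Gaussian measure `N_d(A)` on `ℝ^d` with covariance matrix `A`. -/
noncomputable def gaussian {d : ℕ} (A : Matrix (Fin d) (Fin d) ℝ) :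
    Measure (EuclideanSpace ℝ (Fin d)) :=
  multivariateGaussian 0 A

/-- The centered Gaussian measure `N_{2d}(S)` on `ℝ^d × ℝ^d`. The index type `Fin d ⊕ Fin d`
lists the coordinates of the first factor, then those of the second one. -/
noncomputable def gaussianProd {d : ℕ} (S : Matrix (Fin d ⊕ Fin d) (Fin d ⊕ Fin d) ℝ) :
    Measure (EuclideanSpace ℝ (Fin d) × EuclideanSpace ℝ (Fin d)) :=
  (multivariateGaussian 0 S).map (EuclideanSpace.sumEquivProd (𝕜 := ℝ))

/-- The Hilbert-Schmidt inner product `tr (X Yᵀ)`. -/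
def hsInner {d : ℕ} (X Y : Matrix (Fin d) (Fin d) ℝ) : ℝ := (X * Yᵀ).trace

open Classical in
/-- The extended log-determinant: `log det X` if `X` is symmetric positive-definite, and `-∞`
otherwise. -/
noncomputable def logDet {n : Type*} [Fintype n] [DecidableEq n] (X : Matrix n n ℝ) : EReal :=
  if X.PosDef then ((Real.log X.det : ℝ) : EReal) else ⊥

/-- `M_ε = I - ε Γ₁₂`, where `Γ = S⁻¹`. -/
noncomputable def crossMatrix {d : ℕ} (ε : ℝ) (S : Matrix (Fin d ⊕ Fin d) (Fin d ⊕ Fin d) ℝ) :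
    Matrix (Fin d) (Fin d) ℝ :=
  1 - ε • (S⁻¹).toBlocks₁₂

/-- The dual objective
`⟨I + εΓ₁₁ - F, A⟩ + ⟨I + εΓ₂₂ - G, B⟩ + ε log det [[F, -M_ε], [-M_εᵀ, G]] - ε log det (ε S⁻¹)`,
where `Γ = S⁻¹`, with values in `[-∞, ∞]`. -/
noncomputable def dualObjective {d : ℕ} (ε : ℝ) (A B : Matrix (Fin d) (Fin d) ℝ)
    (S : Matrix (Fin d ⊕ Fin d) (Fin d ⊕ Fin d) ℝ) (F G : Matrix (Fin d) (Fin d) ℝ) : EReal :=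
  ((hsInner (1 + ε • (S⁻¹).toBlocks₁₁ - F) A + hsInner (1 + ε • (S⁻¹).toBlocks₂₂ - G) B : ℝ) :
      EReal)
    + (ε : EReal) * logDet (fromBlocks F (-crossMatrix ε S) (-(crossMatrix ε S)ᵀ) G)
    - (ε : EReal) * logDet (ε • S⁻¹)

end GaussianEOT

/-! Write Q for the block matrix [[F, -M_ε], [-M_εᵀ, G]] and C = εQ⁻¹. The off-diagonal blocks of Q
are chosen so that ‖x - y‖² + 2ε log(dN(C)/dN(Σ)) has no cross term in x and y: it is a function of
x plus a function of y plus a constant. Its integral is therefore the same for all couplings, and it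
equals the dual objective at (F, G) (`integral_cost_add_logDensity`).

By the chain rule KL(π | N(Σ)) = KL(π | N(C)) + ∫ log(dN(C)/dN(Σ)) dπ, every coupling with finite
divergence satisfies primal(π) = dual(F, G) + 2ε KL(π | N(C)) (`integral_cost_add_klDiv`). Weak
duality is the nonnegativity of the last term, and the gap vanishes at π = N(C) as soon as N(C) is a
coupling, that is, when the diagonal blocks of εQ⁻¹ are A and B. Through Schur complements this
requirement becomes a Riccati equation, which is solved explicitly (`exists_posDef_fromBlocks_inv`,
`exists_optimal_dual`). -/

namespace GaussianEOT

/-! ### Matrix algebra: completing a block matrix from the diagonal blocks of its inverse. -/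

section Riccati

open scoped MatrixOrder

variable {n : Type*} [Fintype n] [DecidableEq n]

/-- The quadratic equation `U² - U = L` has a positive-definite solution. -/
lemma exists_posDef_sq_sub_self {L : Matrix n n ℝ} (hL : L.PosSemidef) :
    ∃ U : Matrix n n ℝ, U.PosDef ∧ U * U - U = L := by
  have h4 : (1 + (4 : ℝ) • L).PosSemidef := PosSemidef.one.add (hL.smul (by norm_num))
  have hR := CFC.sqrt_mul_sqrt_self _ h4.nonneg
  have hR0 : (CFC.sqrt (1 + (4 : ℝ) • L)).PosSemidef :=
    nonneg_iff_posSemidef.1 (CFC.sqrt_nonneg _)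
  set R := CFC.sqrt (1 + (4 : ℝ) • L)
  -- The quadratic formula; the root with the plus sign is the positive-definite one.
  refine ⟨(1 / 2 : ℝ) • (1 + R), (PosDef.one.add_posSemidef hR0).smul (by norm_num), ?_⟩
  have : ((1 / 2 : ℝ) • (1 + R)) * ((1 / 2 : ℝ) • (1 + R))
      = (1 / 4 : ℝ) • (1 + (2 : ℝ) • R + R * R) := by
    rw [smul_mul_smul_comm, add_mul, mul_add, mul_add]
    simp only [one_mul, mul_one]
    module
  rw [this, hR]
  module

/-- The Riccati equation `T K T + T = B` has a positive-definite solution. -/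
lemma exists_posDef_riccati {K B : Matrix n n ℝ} (hK : K.PosSemidef) (hB : B.PosDef) :
    ∃ T : Matrix n n ℝ, T.PosDef ∧ T * K * T + T = B := by
  have hR := CFC.sqrt_mul_sqrt_self _ hB.posSemidef.nonneg
  have hR0 : (CFC.sqrt B).PosSemidef := nonneg_iff_posSemidef.1 (CFC.sqrt_nonneg _)
  set R := CFC.sqrt B
  have hRu : IsUnit R := isUnit_of_mul_isUnit_left (hR ▸ hB.isUnit)
  have hL : (R * K * R).PosSemidef := by
    have := hK.mul_mul_conjTranspose_same R
    rwa [hR0.isHermitian.eq] at this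
  obtain ⟨U, hU, hUL⟩ := exists_posDef_sq_sub_self hL
  have hUdet : IsUnit U.det := (isUnit_iff_isUnit_det U).1 hU.isUnit
  -- With R = √B and T = R U⁻¹ R, the equation reduces to U⁻¹ L U⁻¹ + U⁻¹ = 1 for L = R K R, that
  -- is, U² - U = L.
  refine ⟨R * U⁻¹ * R, ?_, ?_⟩
  · have := hU.inv.mul_mul_conjTranspose_same (B := R) (vecMul_injective_of_isUnit hRu)
    rwa [hR0.isHermitian.eq] at this
  · calc R * U⁻¹ * R * K * (R * U⁻¹ * R) + R * U⁻¹ * R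
        = R * (U⁻¹ * (R * K * R) * U⁻¹ + U⁻¹) * R := by noncomm_ring
      _ = R * R := by
        rw [← hUL, mul_sub, nonsing_inv_mul_cancel_left _ _ hUdet, nonsing_inv_mul _ hUdet, sub_mul,
          mul_nonsing_inv _ hUdet, one_mul, sub_add_cancel, mul_one]
      _ = B := hR

/-- A positive-definite block matrix with prescribed off-diagonal block `-N` whose inverse has
prescribed diagonal blocks. -/
lemma exists_posDef_fromBlocks_inv {A B : Matrix n n ℝ} (hA : A.PosDef) (hB : B.PosDef)
    (N : Matrix n n ℝ) :
    ∃ F G : Matrix n n ℝ, F.PosDef ∧ G.PosDef ∧ (fromBlocks F (-N) (-Nᵀ) G).PosDef ∧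
      (fromBlocks F (-N) (-Nᵀ) G)⁻¹.toBlocks₁₁ = A ∧
      (fromBlocks F (-N) (-Nᵀ) G)⁻¹.toBlocks₂₂ = B := by
  have hK : (Nᵀ * A * N).PosSemidef := by
    have := hA.posSemidef.conjTranspose_mul_mul_same N
    rwa [conjTranspose_eq_transpose_of_trivial] at this
  obtain ⟨T, hT, hTB⟩ := exists_posDef_riccati hK hB
  have hTdet : IsUnit T.det := (isUnit_iff_isUnit_det T).1 hT.isUnit
  have hAdet : IsUnit A.det := (isUnit_iff_isUnit_det A).1 hA.isUnit
  have hNT : (N * T * Nᵀ).PosSemidef := by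
    have := hT.posSemidef.mul_mul_conjTranspose_same N
    rwa [conjTranspose_eq_transpose_of_trivial] at this
  -- The first diagonal block of P⁻¹ is the inverse of the Schur complement F - N G⁻¹ Nᵀ, so G = T⁻¹
  -- forces F = A⁻¹ + N T Nᵀ. The second one is then T + T Nᵀ A N T, which is B by the Riccati
  -- equation.
  set P := fromBlocks (A⁻¹ + N * T * Nᵀ) (-N) (-Nᵀ) T⁻¹ with hP
  have hmul : fromBlocks A (A * N * T) (T * Nᵀ * A) B * P = 1 := by
    rw [hP, fromBlocks_multiply, ← fromBlocks_one]
    congr 1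
    · rw [mul_add, mul_nonsing_inv _ hAdet]; noncomm_ring
    · rw [mul_nonsing_inv_cancel_right _ _ hTdet]; simp
    · rw [mul_add, mul_nonsing_inv_cancel_right _ _ hAdet, ← hTB]; noncomm_ring
    · rw [← hTB, add_mul, mul_nonsing_inv_cancel_right _ _ hTdet, mul_nonsing_inv _ hTdet]
      noncomm_ring
  have hinv : P⁻¹ = fromBlocks A (A * N * T) (T * Nᵀ * A) B := inv_eq_left_inv hmul
  refine ⟨A⁻¹ + N * T * Nᵀ, T⁻¹, hA.inv.add_posSemidef hNT, hT.inv, ?_, ?_, ?_⟩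
  -- The Schur complement of T⁻¹ in P is A⁻¹; invertibility then upgrades semidefinite to definite.
  · have hps : P.PosSemidef := by
      have := hT.inv.isUnit.invertible
      have h := PosDef.fromBlocks₂₂ (A⁻¹ + N * T * Nᵀ) (-N) hT.inv
      rw [conjTranspose_eq_transpose_of_trivial, transpose_neg] at h
      rw [hP, h, nonsing_inv_nonsing_inv _ hTdet]
      convert! hA.inv.posSemidef using 1
      noncomm_ring
    exact hps.posDef_iff_isUnit.2 (IsUnit.of_mul_eq_one_right _ hmul)
  · rw [hinv, toBlocks_fromBlocks₁₁]
  · rw [hinv, toBlocks_fromBlocks₂₂]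

end Riccati

/-! ### Densities, marginals and second moments of Gaussian measures. -/

section Density

open scoped RealInnerProductSpace MatrixOrder

lemma integrable_exp_neg_norm_sq (V : Type*) [NormedAddCommGroup V] [InnerProductSpace ℝ V]
    [FiniteDimensional ℝ V] [MeasurableSpace V] [BorelSpace V] :
    Integrable fun v : V ↦ Real.exp (-‖v‖ ^ 2 / 2) := by
  have h := (GaussianFourier.integrable_cexp_neg_mul_sq_norm_add (V := V) (b := 1 / 2)
    (by norm_num) 0 0).norm
  refine h.congr (.of_forall fun v ↦ ?_)
  simp only [Complex.norm_exp]
  congr 1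
  simp [← Complex.ofReal_pow]
  ring

/-- The standard Gaussian measure has a density proportional to `exp (-‖x‖² / 2)`. -/
lemma stdGaussian_eq_tilted (V : Type*) [NormedAddCommGroup V] [InnerProductSpace ℝ V]
    [FiniteDimensional ℝ V] [MeasurableSpace V] [BorelSpace V] :
    stdGaussian V = volume.tilted fun v : V ↦ -‖v‖ ^ 2 / 2 := by
  have := isProbabilityMeasure_tilted (integrable_exp_neg_norm_sq V)
  -- Both characteristic functions are exp(-‖t‖² / 2).
  apply Measure.ext_of_charFun
  ext t
  have hb : (0 : ℝ) < ((1 / 2 : ℂ)).re := by norm_num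
  have h := GaussianFourier.integral_cexp_neg_mul_sq_norm_add hb Complex.I t
  have h0 := GaussianFourier.integral_cexp_neg_mul_sq_norm (V := V) hb
  set Z : ℝ := ∫ v : V, Real.exp (-‖v‖ ^ 2 / 2) with hZ
  have hZpos : 0 < Z := integral_exp_pos (integrable_exp_neg_norm_sq V)
  have hZ0 : ∫ v : V, Complex.exp (-(1 / 2) * (‖v‖ : ℂ) ^ 2) = Z := by
    rw [hZ, ← integral_complex_ofReal]
    congr 1 with v
    push_cast
    congr 1
    ring
  rw [← h0, hZ0] at h
  rw [charFun_stdGaussian, charFun_apply, integral_tilted, ← hZ]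
  have : ∀ v : V, (Real.exp (-‖v‖ ^ 2 / 2) / Z) • Complex.exp (⟪v, t⟫ * Complex.I)
      = (Z : ℂ)⁻¹ * Complex.exp (-(1 / 2) * (‖v‖ : ℂ) ^ 2 + Complex.I * ⟪t, v⟫) := by
    intro v
    rw [Complex.exp_add, real_inner_comm, Complex.real_smul]
    push_cast
    ring_nf
  simp_rw [this]
  rw [integral_const_mul, h, inv_mul_cancel_left₀ (by exact_mod_cast hZpos.ne')]
  congr 1
  rw [Complex.I_sq]
  ring

lemma withDensity_comp_map {α β : Type*} [MeasurableSpace α] [MeasurableSpace β] (μ : Measure α)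
    {T : α → β} (hT : Measurable T) {g : β → ℝ≥0∞} (hg : Measurable g) :
    (μ.withDensity (g ∘ T)).map T = (μ.map T).withDensity g := by
  ext s hs
  rw [Measure.map_apply hT hs, withDensity_apply _ (hT hs), withDensity_apply _ hs,
    setLIntegral_map hs hg hT]
  rfl

@[fun_prop]
lemma measurable_quadratic {ι : Type*} [Fintype ι] (H : Matrix ι ι ℝ) :
    Measurable fun x : EuclideanSpace ℝ ι ↦ x.ofLp ⬝ᵥ H *ᵥ x.ofLp := by
  simp only [dotProduct, mulVec]
  fun_prop

variable {ι : Type*} [Fintype ι] [DecidableEq ι]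

/-- The density of a nondegenerate centered multivariate Gaussian measure. -/
lemma multivariateGaussian_eq_withDensity (ι : Type*) [Fintype ι] [DecidableEq ι] :
    ∃ c : ℝ, 0 < c ∧ ∀ S : Matrix ι ι ℝ, S.PosDef → multivariateGaussian 0 S =
      (volume : Measure (EuclideanSpace ℝ ι)).withDensity fun x ↦
        ENNReal.ofReal (c * (√S.det)⁻¹ * Real.exp (-(x.ofLp ⬝ᵥ S⁻¹ *ᵥ x.ofLp) / 2)) := by
  set Z : ℝ := ∫ v : EuclideanSpace ℝ ι, Real.exp (-‖v‖ ^ 2 / 2) with hZ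
  have hZpos : 0 < Z := integral_exp_pos (integrable_exp_neg_norm_sq _)
  -- The constant need not be computed: it does not depend on S, so it cancels in the ratio of two
  -- Gaussian densities.
  refine ⟨Z⁻¹, inv_pos.2 hZpos, fun S hS ↦ ?_⟩
  have hR := CFC.sqrt_mul_sqrt_self _ hS.posSemidef.nonneg
  have hR0 : (CFC.sqrt S).PosSemidef := nonneg_iff_posSemidef.1 (CFC.sqrt_nonneg _)
  rw [multivariateGaussian, stdGaussian_eq_tilted, Measure.tilted, ← hZ]
  simp only [zero_add]
  set R := CFC.sqrt S
  have hdet : R.det * R.det = S.det := by rw [← det_mul, hR]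
  have hRpos : 0 < R.det := by
    have := hS.det_pos
    have := hR0.det_nonneg
    rcases this.eq_or_lt with h | h
    · rw [← h] at hdet; simp at hdet; linarith
    · exact h
  have hRdet : IsUnit R.det := hRpos.ne'.isUnit
  have hsqrt : √S.det = R.det := by rw [← hdet, Real.sqrt_mul_self hRpos.le]
  have hmap : (volume : Measure (EuclideanSpace ℝ ι)).map (toEuclideanCLM (𝕜 := ℝ) R)
      = ENNReal.ofReal (R.det)⁻¹ • volume := by
    have hd : LinearMap.det (toEuclideanLin R) = R.det := by
      rw [toEuclideanLin_eq_toLin_orthonormal, LinearMap.det_toLin]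
    have := Measure.map_linearMap_addHaar_eq_smul_addHaar
      (volume : Measure (EuclideanSpace ℝ ι)) (f := toEuclideanLin R) (by rw [hd]; exact hRpos.ne')
    rw [hd, abs_of_pos (inv_pos.2 hRpos)] at this
    exact this
  have hq : ∀ v : EuclideanSpace ℝ ι,
      (toEuclideanCLM (𝕜 := ℝ) R v).ofLp ⬝ᵥ S⁻¹ *ᵥ (toEuclideanCLM (𝕜 := ℝ) R v).ofLp
        = ‖v‖ ^ 2 := by
    intro v
    have hRSR : R * (S⁻¹ * R) = 1 := by
      rw [← hR, Matrix.mul_inv_rev, Matrix.mul_assoc, nonsing_inv_mul _ hRdet, Matrix.mul_one,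
        mul_nonsing_inv _ hRdet]
    have hRt : Rᵀ = R := by
      rw [← conjTranspose_eq_transpose_of_trivial]; exact hR0.isHermitian
    rw [ofLp_toEuclideanCLM, mulVec_mulVec, dotProduct_comm, dotProduct_mulVec, ← mulVec_transpose,
      hRt, mulVec_mulVec, hRSR, one_mulVec, EuclideanSpace.real_norm_sq_eq, dotProduct]
    simp only [sq]
  -- By `hq` the standard density factors through v ↦ R v, hence it passes to the image measure.
  have hfun : (fun x : EuclideanSpace ℝ ι ↦ ENNReal.ofReal (Real.exp (-‖x‖ ^ 2 / 2) / Z))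
      = (fun x : EuclideanSpace ℝ ι ↦
          ENNReal.ofReal (Z⁻¹ * Real.exp (-(x.ofLp ⬝ᵥ S⁻¹ *ᵥ x.ofLp) / 2)))
        ∘ (toEuclideanCLM (𝕜 := ℝ) R) := by
    ext v
    simp only [Function.comp_apply, hq]
    rw [div_eq_inv_mul]
  rw [hfun, withDensity_comp_map _ (by fun_prop) (by fun_prop), hmap, withDensity_smul_measure,
    ← withDensity_smul _ (by fun_prop), hsqrt]
  congr 1 with x
  rw [Pi.smul_apply, smul_eq_mul, ← ENNReal.ofReal_mul (by positivity)]
  congr 1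
  ring

/-- The density of a nondegenerate centered Gaussian measure with respect to another one. -/
lemma multivariateGaussian_withDensity {S C : Matrix ι ι ℝ} (hS : S.PosDef) (hC : C.PosDef) :
    multivariateGaussian 0 C = (multivariateGaussian 0 S).withDensity fun x ↦
      ENNReal.ofReal (Real.exp ((x.ofLp ⬝ᵥ (S⁻¹ - C⁻¹) *ᵥ x.ofLp) / 2
        + Real.log (S.det / C.det) / 2)) := by
  obtain ⟨c, hc, h⟩ := multivariateGaussian_eq_withDensity ι
  rw [h S hS, h C hC, ← withDensity_mul _ (by fun_prop) (by fun_prop)]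
  congr 1 with x
  have hSd := hS.det_pos
  have hCd := hC.det_pos
  rw [Pi.mul_apply, ← ENNReal.ofReal_mul (by positivity)]
  congr 1
  rw [← Real.log_sqrt (by positivity), Real.exp_add, Real.exp_log (by positivity),
    Real.sqrt_div hSd.le, sub_mulVec, dotProduct_sub, sub_div, sub_eq_add_neg, Real.exp_add,
    neg_div, neg_div, Real.exp_neg]
  have h1 : 0 < √S.det := Real.sqrt_pos.2 hSd
  have h2 : 0 < √C.det := Real.sqrt_pos.2 hCd
  rw [Real.exp_neg]
  field_simp

/-- The image of a centered multivariate Gaussian measure under a selection of coordinates. -/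
lemma map_comp_multivariateGaussian {κ : Type*} [Fintype κ] [DecidableEq κ] {S : Matrix ι ι ℝ}
    (hS : S.PosSemidef) (f : κ → ι) (L : EuclideanSpace ℝ ι →L[ℝ] EuclideanSpace ℝ κ)
    (hL : ∀ x j, L x j = x (f j)) :
    (multivariateGaussian 0 S).map L = multivariateGaussian 0 (S.submatrix f f) := by
  -- A Gaussian measure is determined by its mean and covariance; the covariances are compared on
  -- the coordinate basis.
  apply IsGaussian.ext
  · simp only [id_eq, integral_id_multivariateGaussian]
    rw [ContinuousLinearMap.integral_id_map, integral_id_multivariateGaussian, map_zero]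
    exact IsGaussian.integrable_id
  rw [← ContinuousLinearMap.toBilinForm_inj]
  refine LinearMap.BilinForm.ext_basis (EuclideanSpace.basisFun κ ℝ).toBasis fun i j ↦ ?_
  rw [ContinuousLinearMap.toBilinForm_apply, ContinuousLinearMap.toBilinForm_apply,
    covarianceBilin_apply_eq_cov, covariance_map]
  · have (i : κ) : (fun u ↦ ⟪(EuclideanSpace.basisFun κ ℝ).toBasis i, u⟫) ∘ L =
        fun u ↦ u (f i) := by ext; simp [PiLp.inner_apply, hL]
    simp_rw [this, covariance_eval_multivariateGaussian hS,
      covarianceBilin_multivariateGaussian (hS.submatrix _)]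
    simp
  any_goals exact Measurable.aestronglyMeasurable (by fun_prop)
  · fun_prop
  · exact IsGaussian.memLp_two_id

lemma integral_mul_multivariateGaussian {S : Matrix ι ι ℝ} (hS : S.PosSemidef) (i j : ι) :
    ∫ x, x i * x j ∂(multivariateGaussian 0 S) = S i j := by
  have hmem (i : ι) : MemLp (fun x : EuclideanSpace ℝ ι ↦ x i) 2 (multivariateGaussian 0 S) :=
    IsGaussian.memLp_dual _ (EuclideanSpace.proj i) 2 (by simp)
  have hz (i : ι) : ∫ x, x i ∂(multivariateGaussian 0 S) = 0 := by
    have := (EuclideanSpace.proj (𝕜 := ℝ) i).integral_comp_comm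
      (IsGaussian.integrable_id (μ := multivariateGaussian (0 : EuclideanSpace ℝ ι) S))
    simp only [id_eq, integral_id_multivariateGaussian, map_zero] at this
    exact this
  rw [← covariance_eval_multivariateGaussian (μ := 0) hS i j, covariance_eq_sub (hmem i) (hmem j),
    hz, hz]
  simp

end Density

/-! ### Kullback-Leibler divergence under an exponential change of reference measure. -/

section KullbackLeibler

variable {α : Type*} [MeasurableSpace α]

lemma integrable_exp_of_withDensity {ν : Measure α} {g : α → ℝ} (hg : Measurable g)
    (h : IsProbabilityMeasure (ν.withDensity fun x ↦ ENNReal.ofReal (Real.exp (g x)))) :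
    Integrable (fun x ↦ Real.exp (g x)) ν ∧ ∫ x, Real.exp (g x) ∂ν = 1 := by
  have h1 : ∫⁻ x, ENNReal.ofReal (Real.exp (g x)) ∂ν = 1 := by
    rw [← setLIntegral_univ, ← withDensity_apply _ MeasurableSet.univ]
    exact measure_univ
  have hm : Measurable fun x ↦ Real.exp (g x) := by fun_prop
  refine ⟨⟨hm.aestronglyMeasurable, ?_⟩, ?_⟩
  · rw [hasFiniteIntegral_iff_ofReal (.of_forall fun x ↦ (Real.exp_pos _).le), h1]
    exact ENNReal.one_lt_top
  · rw [integral_eq_lintegral_of_nonneg_ae (.of_forall fun x ↦ (Real.exp_pos _).le)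
      hm.aestronglyMeasurable, h1, ENNReal.toReal_one]

/-- Total mass one means that the normalising constant of the tilting is 1, so the log-likelihood
results on tilted measures apply. -/
lemma withDensity_exp_eq_tilted {ν : Measure α} {g : α → ℝ} (hg : Measurable g)
    (h : IsProbabilityMeasure (ν.withDensity fun x ↦ ENNReal.ofReal (Real.exp (g x)))) :
    ν.withDensity (fun x ↦ ENNReal.ofReal (Real.exp (g x))) = ν.tilted g := by
  rw [Measure.tilted, (integrable_exp_of_withDensity hg h).2]
  simp

/-- Change of the reference measure in the Kullback-Leibler divergence. -/
lemma toReal_klDiv_withDensity_exp {ν π : Measure α} [IsProbabilityMeasure ν]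
    [IsProbabilityMeasure π] {g : α → ℝ} (hg : Measurable g)
    (h : IsProbabilityMeasure (ν.withDensity fun x ↦ ENNReal.ofReal (Real.exp (g x))))
    (hgπ : Integrable g π) (hπ : klDiv π ν ≠ ∞) :
    (klDiv π ν).toReal
      = (klDiv π (ν.withDensity fun x ↦ ENNReal.ofReal (Real.exp (g x)))).toReal
        + ∫ x, g x ∂π := by
  obtain ⟨hac, hint⟩ := klDiv_ne_top_iff.1 hπ
  obtain ⟨hi, h1⟩ := integrable_exp_of_withDensity hg h
  have hac' : π ≪ ν.withDensity fun x ↦ ENNReal.ofReal (Real.exp (g x)) := by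
    rw [withDensity_exp_eq_tilted hg h]
    exact hac.trans (absolutelyContinuous_tilted hi)
  rw [toReal_klDiv_of_measure_eq hac (by simp), toReal_klDiv_of_measure_eq hac' (by simp),
    withDensity_exp_eq_tilted hg h, integral_llr_tilted_right hac hgπ hi hint, h1]
  simp

/-- The log-likelihood ratio is g almost everywhere, so its integrability is that of g. -/
lemma klDiv_withDensity_exp_ne_top {ν : Measure α} [IsProbabilityMeasure ν] {g : α → ℝ}
    (hg : Measurable g)
    (h : IsProbabilityMeasure (ν.withDensity fun x ↦ ENNReal.ofReal (Real.exp (g x))))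
    (hgπ : Integrable g (ν.withDensity fun x ↦ ENNReal.ofReal (Real.exp (g x)))) :
    klDiv (ν.withDensity fun x ↦ ENNReal.ofReal (Real.exp (g x))) ν ≠ ∞ := by
  obtain ⟨hi, h1⟩ := integrable_exp_of_withDensity hg h
  have hac : ν.withDensity (fun x ↦ ENNReal.ofReal (Real.exp (g x))) ≪ ν :=
    withDensity_absolutelyContinuous _ _
  refine klDiv_ne_top hac ?_
  have hllr := hac.ae_le (llr_tilted_left (Measure.AbsolutelyContinuous.refl ν) hi hg.aemeasurable)
  have hself := hac.ae_le (llr_self ν)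
  refine hgπ.congr ?_
  filter_upwards [hllr, hself] with x hx hx'
  rw [withDensity_exp_eq_tilted hg h, hx, hx', h1]
  simp

end KullbackLeibler

/-! ### Gaussian measures on the product space, in coordinates. -/

variable {d : ℕ}

/-- The coordinates of a pair, as a vector indexed by `Fin d ⊕ Fin d`. -/
def pairCoord (p : EuclideanSpace ℝ (Fin d) × EuclideanSpace ℝ (Fin d)) : Fin d ⊕ Fin d → ℝ :=
  Sum.elim p.1.ofLp p.2.ofLp

lemma pairCoord_sumEquivProd (x : EuclideanSpace ℝ (Fin d ⊕ Fin d)) :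
    pairCoord (EuclideanSpace.sumEquivProd (𝕜 := ℝ) x) = x.ofLp := by
  ext (i | i) <;> rfl

lemma measurable_pairCoord (i : Fin d ⊕ Fin d) :
    Measurable fun p : EuclideanSpace ℝ (Fin d) × EuclideanSpace ℝ (Fin d) ↦ pairCoord p i := by
  rcases i with i | i <;> simp only [pairCoord, Sum.elim_inl, Sum.elim_inr] <;> fun_prop

/-- The log-density of `N_{2d}(C)` with respect to `N_{2d}(S)`. -/
noncomputable def logDensity (S C : Matrix (Fin d ⊕ Fin d) (Fin d ⊕ Fin d) ℝ)
    (p : EuclideanSpace ℝ (Fin d) × EuclideanSpace ℝ (Fin d)) : ℝ :=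
  (pairCoord p ⬝ᵥ (S⁻¹ - C⁻¹) *ᵥ pairCoord p) / 2 + Real.log (S.det / C.det) / 2

lemma measurable_logDensity (S C : Matrix (Fin d ⊕ Fin d) (Fin d ⊕ Fin d) ℝ) :
    Measurable (logDensity S C) := by
  have := measurable_pairCoord (d := d)
  unfold logDensity
  simp only [dotProduct, mulVec]
  fun_prop

instance (S : Matrix (Fin d ⊕ Fin d) (Fin d ⊕ Fin d) ℝ) :
    IsProbabilityMeasure (gaussianProd S) :=
  Measure.isProbabilityMeasure_map (by fun_prop)

instance (A : Matrix (Fin d) (Fin d) ℝ) : IsProbabilityMeasure (gaussian A) := by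
  unfold gaussian
  infer_instance

lemma gaussianProd_eq_withDensity {S C : Matrix (Fin d ⊕ Fin d) (Fin d ⊕ Fin d) ℝ}
    (hS : S.PosDef) (hC : C.PosDef) :
    gaussianProd C = (gaussianProd S).withDensity fun p ↦
      ENNReal.ofReal (Real.exp (logDensity S C p)) := by
  have hm := measurable_logDensity S C
  rw [gaussianProd, gaussianProd, ← withDensity_comp_map _ (by fun_prop) (by fun_prop),
    multivariateGaussian_withDensity hS hC]
  congr 2 with x
  rw [Function.comp_apply, logDensity, pairCoord_sumEquivProd]

lemma gaussianProd_mem_couplings {C : Matrix (Fin d ⊕ Fin d) (Fin d ⊕ Fin d) ℝ}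
    (hC : C.PosDef) :
    gaussianProd C ∈ couplings (gaussian C.toBlocks₁₁) (gaussian C.toBlocks₂₂) := by
  constructor
  · rw [Measure.fst, gaussianProd, Measure.map_map (by fun_prop) (by fun_prop)]
    exact map_comp_multivariateGaussian hC.posSemidef Sum.inl
      (ContinuousLinearMap.fst ℝ _ _ ∘L (EuclideanSpace.sumEquivProd (𝕜 := ℝ)).toContinuousLinearMap)
      fun x j ↦ rfl
  · rw [Measure.snd, gaussianProd, Measure.map_map (by fun_prop) (by fun_prop)]
    exact map_comp_multivariateGaussian hC.posSemidef Sum.inr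
      (ContinuousLinearMap.snd ℝ _ _ ∘L (EuclideanSpace.sumEquivProd (𝕜 := ℝ)).toContinuousLinearMap)
      fun x j ↦ rfl

lemma isProbabilityMeasure_of_mem_couplings {E F : Type*} [MeasurableSpace E] [MeasurableSpace F]
    {μ : Measure E} {ν : Measure F} [IsProbabilityMeasure μ] {π : Measure (E × F)}
    (hπ : π ∈ couplings μ ν) : IsProbabilityMeasure π :=
  ⟨by rw [← Measure.fst_univ, hπ.1, measure_univ]⟩

lemma memLp_gaussian_apply (A : Matrix (Fin d) (Fin d) ℝ) (i : Fin d) :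
    MemLp (fun x : EuclideanSpace ℝ (Fin d) ↦ x i) 2 (gaussian A) :=
  IsGaussian.memLp_dual (multivariateGaussian 0 A) (EuclideanSpace.proj i) 2 (by simp)

lemma integrable_quadratic_gaussian (A H : Matrix (Fin d) (Fin d) ℝ) :
    Integrable (fun x : EuclideanSpace ℝ (Fin d) ↦ x.ofLp ⬝ᵥ H *ᵥ x.ofLp) (gaussian A) := by
  simp only [dotProduct, mulVec, Finset.mul_sum]
  refine integrable_finsetSum _ fun i _ ↦ integrable_finsetSum _ fun j _ ↦ ?_
  have := ((memLp_gaussian_apply A i).integrable_mul (memLp_gaussian_apply A j)).const_mul (H i j)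
  refine this.congr (.of_forall fun x ↦ ?_)
  simp only [Pi.mul_apply]
  ring

/-- The integral of a quadratic form against a centered Gaussian measure. -/
lemma integral_quadratic_gaussian {A : Matrix (Fin d) (Fin d) ℝ} (hA : A.PosSemidef)
    (H : Matrix (Fin d) (Fin d) ℝ) :
    ∫ x : EuclideanSpace ℝ (Fin d), x.ofLp ⬝ᵥ H *ᵥ x.ofLp ∂(gaussian A) = hsInner H A := by
  have hi (i j : Fin d) : Integrable
      (fun x : EuclideanSpace ℝ (Fin d) ↦ x i * (H i j * x j)) (gaussian A) := by
    have := ((memLp_gaussian_apply A i).integrable_mul (memLp_gaussian_apply A j)).const_mul (H i j)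
    refine this.congr (.of_forall fun x ↦ ?_)
    simp only [Pi.mul_apply]
    ring
  simp only [dotProduct, mulVec, Finset.mul_sum]
  rw [integral_finsetSum _ fun i _ ↦ integrable_finsetSum _ fun j _ ↦ hi i j]
  simp only [hsInner, trace, diag_apply, mul_apply, transpose_apply]
  refine Finset.sum_congr rfl fun i _ ↦ ?_
  rw [integral_finsetSum _ fun j _ ↦ hi i j]
  refine Finset.sum_congr rfl fun j _ ↦ ?_
  rw [← integral_mul_multivariateGaussian hA i j, ← integral_const_mul]
  congr 1 with x
  ring

/-! ### Quadratic integrals against couplings of two Gaussian measures. -/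

section Couplings

variable {A B : Matrix (Fin d) (Fin d) ℝ}
  {π : Measure (EuclideanSpace ℝ (Fin d) × EuclideanSpace ℝ (Fin d))}

lemma memLp_pairCoord (hπ : π ∈ couplings (gaussian A) (gaussian B)) (i : Fin d ⊕ Fin d) :
    MemLp (fun p ↦ pairCoord p i) 2 π := by
  rcases i with i | i
  · have := memLp_gaussian_apply A i
    rw [← hπ.1] at this
    exact this.comp_of_map (by fun_prop)
  · have := memLp_gaussian_apply B i
    rw [← hπ.2] at this
    exact this.comp_of_map (by fun_prop)

lemma integrable_quadratic_pairCoord (hπ : π ∈ couplings (gaussian A) (gaussian B))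
    (H : Matrix (Fin d ⊕ Fin d) (Fin d ⊕ Fin d) ℝ) :
    Integrable (fun p ↦ pairCoord p ⬝ᵥ H *ᵥ pairCoord p) π := by
  simp only [dotProduct, mulVec, Finset.mul_sum]
  refine integrable_finsetSum _ fun i _ ↦ integrable_finsetSum _ fun j _ ↦ ?_
  have := ((memLp_pairCoord hπ i).integrable_mul (memLp_pairCoord hπ j)).const_mul (H i j)
  refine this.congr (.of_forall fun x ↦ ?_)
  simp only [Pi.mul_apply]
  ring

lemma integrable_logDensity (hπ : π ∈ couplings (gaussian A) (gaussian B))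
    (S C : Matrix (Fin d ⊕ Fin d) (Fin d ⊕ Fin d) ℝ) : Integrable (logDensity S C) π := by
  have := isProbabilityMeasure_of_mem_couplings hπ
  exact ((integrable_quadratic_pairCoord hπ _).div_const 2).add (integrable_const _)

lemma norm_sub_sq_eq (p : EuclideanSpace ℝ (Fin d) × EuclideanSpace ℝ (Fin d)) :
    ‖p.1 - p.2‖ ^ 2 = pairCoord p ⬝ᵥ (fromBlocks 1 (-1) (-1) 1 : Matrix _ _ ℝ) *ᵥ pairCoord p := by
  rw [EuclideanSpace.real_norm_sq_eq]
  simp only [pairCoord, fromBlocks_mulVec, Sum.elim_comp_inl, Sum.elim_comp_inr, dotProduct,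
    Fintype.sum_sum_type, Sum.elim_inl, Sum.elim_inr, ← Finset.sum_add_distrib]
  refine Finset.sum_congr rfl fun i _ ↦ ?_
  simp [neg_mulVec]
  ring

/-- The quadratic part of the cost and of the log-density splits over the two marginals. -/
lemma quadratic_split {S : Matrix (Fin d ⊕ Fin d) (Fin d ⊕ Fin d) ℝ} (hS : S.PosDef) (ε : ℝ)
    (F G : Matrix (Fin d) (Fin d) ℝ)
    (p : EuclideanSpace ℝ (Fin d) × EuclideanSpace ℝ (Fin d)) :
    ‖p.1 - p.2‖ ^ 2 + pairCoord p ⬝ᵥ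
        (ε • S⁻¹ - fromBlocks F (-crossMatrix ε S) (-(crossMatrix ε S)ᵀ) G) *ᵥ pairCoord p
      = p.1.ofLp ⬝ᵥ (1 + ε • (S⁻¹).toBlocks₁₁ - F) *ᵥ p.1.ofLp
        + p.2.ofLp ⬝ᵥ (1 + ε • (S⁻¹).toBlocks₂₂ - G) *ᵥ p.2.ofLp := by
  have hsymm : (S⁻¹).toBlocks₂₁ = (S⁻¹).toBlocks₁₂ᵀ := by
    have := hS.inv.isHermitian
    rw [IsHermitian, conjTranspose_eq_transpose_of_trivial] at this
    ext i j
    exact (congrFun₂ this (Sum.inr i) (Sum.inl j)).symm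
  have hblock : (fromBlocks 1 (-1) (-1) 1 : Matrix (Fin d ⊕ Fin d) (Fin d ⊕ Fin d) ℝ)
      + (ε • S⁻¹ - fromBlocks F (-crossMatrix ε S) (-(crossMatrix ε S)ᵀ) G)
      = fromBlocks (1 + ε • (S⁻¹).toBlocks₁₁ - F) 0 0 (1 + ε • (S⁻¹).toBlocks₂₂ - G) := by
    conv_lhs => rw [← fromBlocks_toBlocks S⁻¹, hsymm]
    rw [fromBlocks_smul, sub_eq_add_neg, fromBlocks_neg, fromBlocks_add, fromBlocks_add]
    congr 1
    · abel
    · rw [crossMatrix]; abel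
    · rw [crossMatrix, transpose_sub, transpose_smul, transpose_one]; abel
    · abel
  rw [norm_sub_sq_eq, ← dotProduct_add, ← add_mulVec, hblock]
  simp [pairCoord, fromBlocks_mulVec, dotProduct, Fintype.sum_sum_type]

/-! ### Weak duality, the duality gap and its equality case. -/

/-- The value of the dual objective when the block matrix is positive-definite. -/
noncomputable def dualReal (ε : ℝ) (A B : Matrix (Fin d) (Fin d) ℝ)
    (S : Matrix (Fin d ⊕ Fin d) (Fin d ⊕ Fin d) ℝ) (F G : Matrix (Fin d) (Fin d) ℝ) : ℝ :=
  hsInner (1 + ε • (S⁻¹).toBlocks₁₁ - F) A + hsInner (1 + ε • (S⁻¹).toBlocks₂₂ - G) B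
    + ε * Real.log (fromBlocks F (-crossMatrix ε S) (-(crossMatrix ε S)ᵀ) G).det
    - ε * Real.log (ε • S⁻¹).det

lemma dualObjective_eq_dualReal {S : Matrix (Fin d ⊕ Fin d) (Fin d ⊕ Fin d) ℝ} (hS : S.PosDef)
    {ε : ℝ} (hε : 0 < ε) {F G : Matrix (Fin d) (Fin d) ℝ}
    (hQ : (fromBlocks F (-crossMatrix ε S) (-(crossMatrix ε S)ᵀ) G).PosDef) :
    dualObjective ε A B S F G = (dualReal ε A B S F G : EReal) := by
  rw [dualObjective, logDet, logDet, if_pos hQ, if_pos (hS.inv.smul hε), dualReal]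
  push_cast
  rfl

lemma dualObjective_eq_bot {S : Matrix (Fin d ⊕ Fin d) (Fin d ⊕ Fin d) ℝ}
    {ε : ℝ} (hε : 0 < ε) {F G : Matrix (Fin d) (Fin d) ℝ}
    (hQ : ¬ (fromBlocks F (-crossMatrix ε S) (-(crossMatrix ε S)ᵀ) G).PosDef) :
    dualObjective ε A B S F G = ⊥ := by
  rw [dualObjective, logDet, if_neg hQ, EReal.coe_mul_bot_of_pos hε, EReal.add_bot, EReal.bot_sub]

/-- The integrand separates into functions of the two marginals, so the right-hand side does not
depend on the coupling. -/
lemma integral_cost_add_logDensity (hA : A.PosDef) (hB : B.PosDef)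
    {S : Matrix (Fin d ⊕ Fin d) (Fin d ⊕ Fin d) ℝ} (hS : S.PosDef)
    {ε : ℝ} (hε : 0 < ε) {F G : Matrix (Fin d) (Fin d) ℝ}
    (hQ : (fromBlocks F (-crossMatrix ε S) (-(crossMatrix ε S)ᵀ) G).PosDef)
    (hπ : π ∈ couplings (gaussian A) (gaussian B)) :
    ∫ p, ‖p.1 - p.2‖ ^ 2 ∂π + 2 * ε * ∫ p, logDensity S
        (ε • (fromBlocks F (-crossMatrix ε S) (-(crossMatrix ε S)ᵀ) G)⁻¹) p ∂π
      = dualReal ε A B S F G := by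
  have := isProbabilityMeasure_of_mem_couplings hπ
  rw [dualReal]
  set Q := fromBlocks F (-crossMatrix ε S) (-(crossMatrix ε S)ᵀ) G with hQdef
  have hQdet : IsUnit Q.det := hQ.det_pos.ne'.isUnit
  have hCinv : (ε • Q⁻¹)⁻¹ = ε⁻¹ • Q := by
    refine inv_eq_left_inv ?_
    rw [smul_mul_smul_comm, mul_nonsing_inv _ hQdet, inv_mul_cancel₀ hε.ne', one_smul]
  -- After cross-multiplication both sides are det(ε • 1), so no power of ε has to be made explicit.
  have hdet : S.det / (ε • Q⁻¹).det = Q.det / (ε • S⁻¹).det := by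
    rw [div_eq_div_iff (hQ.inv.smul hε).det_pos.ne' (hS.inv.smul hε).det_pos.ne', ← det_mul,
      ← det_mul, Matrix.mul_smul, Matrix.mul_smul, mul_nonsing_inv _ hQdet,
      mul_nonsing_inv _ hS.det_pos.ne'.isUnit]
  have hlog : Real.log (S.det / (ε • Q⁻¹).det) = Real.log Q.det - Real.log (ε • S⁻¹).det := by
    rw [hdet, Real.log_div hQ.det_pos.ne' (hS.inv.smul hε).det_pos.ne']
  have hcost : Integrable (fun p ↦ ‖p.1 - p.2‖ ^ 2) π := by
    simp_rw [norm_sub_sq_eq]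
    exact integrable_quadratic_pairCoord hπ _
  have hpt (p) : ‖p.1 - p.2‖ ^ 2 + 2 * ε * logDensity S (ε • Q⁻¹) p
      = (p.1.ofLp ⬝ᵥ (1 + ε • (S⁻¹).toBlocks₁₁ - F) *ᵥ p.1.ofLp
        + p.2.ofLp ⬝ᵥ (1 + ε • (S⁻¹).toBlocks₂₂ - G) *ᵥ p.2.ofLp)
        + (ε * Real.log Q.det - ε * Real.log (ε • S⁻¹).det) := by
    have h1 : ε • S⁻¹ - Q = ε • (S⁻¹ - ε⁻¹ • Q) := by
      rw [smul_sub, smul_smul, mul_inv_cancel₀ hε.ne', one_smul]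
    rw [← quadratic_split hS ε F G p, ← hQdef, logDensity, hCinv, hlog, h1, smul_mulVec,
      dotProduct_smul, smul_eq_mul]
    ring
  rw [← integral_const_mul, ← integral_add hcost ((integrable_logDensity hπ _ _).const_mul _)]
  simp_rw [hpt]
  have hi1 : Integrable (fun p : EuclideanSpace ℝ (Fin d) × EuclideanSpace ℝ (Fin d) ↦
      p.1.ofLp ⬝ᵥ (1 + ε • (S⁻¹).toBlocks₁₁ - F) *ᵥ p.1.ofLp) π := by
    have := integrable_quadratic_gaussian A (1 + ε • (S⁻¹).toBlocks₁₁ - F)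
    rw [← hπ.1] at this
    exact this.comp_measurable measurable_fst
  have hi2 : Integrable (fun p : EuclideanSpace ℝ (Fin d) × EuclideanSpace ℝ (Fin d) ↦
      p.2.ofLp ⬝ᵥ (1 + ε • (S⁻¹).toBlocks₂₂ - G) *ᵥ p.2.ofLp) π := by
    have := integrable_quadratic_gaussian B (1 + ε • (S⁻¹).toBlocks₂₂ - G)
    rw [← hπ.2] at this
    exact this.comp_measurable measurable_snd
  rw [integral_add (by exact hi1.add hi2) (integrable_const _), integral_add hi1 hi2,
    ← integral_quadratic_gaussian hA.posSemidef, ← integral_quadratic_gaussian hB.posSemidef]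
  rw [← hπ.1, ← hπ.2, Measure.fst, Measure.snd,
    integral_map (by fun_prop) (measurable_quadratic _).aestronglyMeasurable,
    integral_map (by fun_prop) (measurable_quadratic _).aestronglyMeasurable]
  simp
  ring

/-- The gap between the primal and the dual objective is a Kullback-Leibler divergence. -/
lemma integral_cost_add_klDiv (hA : A.PosDef) (hB : B.PosDef)
    {S : Matrix (Fin d ⊕ Fin d) (Fin d ⊕ Fin d) ℝ} (hS : S.PosDef)
    {ε : ℝ} (hε : 0 < ε) {F G : Matrix (Fin d) (Fin d) ℝ}
    (hQ : (fromBlocks F (-crossMatrix ε S) (-(crossMatrix ε S)ᵀ) G).PosDef)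
    (hπ : π ∈ couplings (gaussian A) (gaussian B)) (hkl : klDiv π (gaussianProd S) ≠ ∞) :
    ∫ p, ‖p.1 - p.2‖ ^ 2 ∂π + 2 * ε * (klDiv π (gaussianProd S)).toReal
      = dualReal ε A B S F G + 2 * ε * (klDiv π (gaussianProd
        (ε • (fromBlocks F (-crossMatrix ε S) (-(crossMatrix ε S)ᵀ) G)⁻¹))).toReal := by
  have := isProbabilityMeasure_of_mem_couplings hπ
  have hdens := gaussianProd_eq_withDensity hS (hQ.inv.smul hε)
  have hprob := hdens ▸ (inferInstance : IsProbabilityMeasure (gaussianProd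
    (ε • (fromBlocks F (-crossMatrix ε S) (-(crossMatrix ε S)ᵀ) G)⁻¹)))
  rw [toReal_klDiv_withDensity_exp (measurable_logDensity _ _) hprob
    (integrable_logDensity hπ _ _) hkl, ← integral_cost_add_logDensity hA hB hS hε hQ hπ, ← hdens]
  ring

lemma objective_eq_ofReal {S : Matrix (Fin d ⊕ Fin d) (Fin d ⊕ Fin d) ℝ} {ε : ℝ} (hε : 0 < ε)
    (hπ : π ∈ couplings (gaussian A) (gaussian B)) (hkl : klDiv π (gaussianProd S) ≠ ∞) :
    objective ε (gaussianProd S) π = ENNReal.ofReal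
      (∫ p, ‖p.1 - p.2‖ ^ 2 ∂π + 2 * ε * (klDiv π (gaussianProd S)).toReal) := by
  have hcost : Integrable (fun p ↦ ‖p.1 - p.2‖ ^ 2) π := by
    simp_rw [norm_sub_sq_eq]
    exact integrable_quadratic_pairCoord hπ _
  rw [objective, ← ofReal_integral_eq_lintegral_ofReal hcost (.of_forall fun p ↦ by positivity),
    ENNReal.ofReal_add (integral_nonneg fun p ↦ by positivity) (by positivity),
    ENNReal.ofReal_mul (p := 2 * ε) (by positivity), ENNReal.ofReal_toReal hkl]

lemma dualObjective_le_objective (hA : A.PosDef) (hB : B.PosDef)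
    {S : Matrix (Fin d ⊕ Fin d) (Fin d ⊕ Fin d) ℝ} (hS : S.PosDef)
    {ε : ℝ} (hε : 0 < ε) (F G : Matrix (Fin d) (Fin d) ℝ)
    (hπ : π ∈ couplings (gaussian A) (gaussian B)) :
    dualObjective ε A B S F G ≤ (objective ε (gaussianProd S) π : EReal) := by
  by_cases hQ : (fromBlocks F (-crossMatrix ε S) (-(crossMatrix ε S)ᵀ) G).PosDef
  · by_cases hkl : klDiv π (gaussianProd S) = ∞
    · rw [objective, hkl, ENNReal.mul_top (by simpa using hε), add_top]
      simp
    · rw [objective_eq_ofReal hε hπ hkl, integral_cost_add_klDiv hA hB hS hε hQ hπ hkl,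
        dualObjective_eq_dualReal hS hε hQ, EReal.coe_ennreal_ofReal, EReal.coe_le_coe_iff]
      -- The maximum with 0 comes from `ENNReal.ofReal`; weak duality is the nonnegativity of the
      -- divergence.
      refine le_max_of_le_left (le_add_of_nonneg_right ?_)
      positivity
  · rw [dualObjective_eq_bot hε hQ]
    exact bot_le

/-- The Gaussian plan with precision matrix `ε⁻¹ Q` closes the duality gap. -/
lemma objective_gaussianProd (hA : A.PosDef) (hB : B.PosDef)
    {S : Matrix (Fin d ⊕ Fin d) (Fin d ⊕ Fin d) ℝ} (hS : S.PosDef)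
    {ε : ℝ} (hε : 0 < ε) {F G : Matrix (Fin d) (Fin d) ℝ}
    (hQ : (fromBlocks F (-crossMatrix ε S) (-(crossMatrix ε S)ᵀ) G).PosDef)
    (hπ : gaussianProd (ε • (fromBlocks F (-crossMatrix ε S) (-(crossMatrix ε S)ᵀ) G)⁻¹)
      ∈ couplings (gaussian A) (gaussian B)) :
    (objective ε (gaussianProd S)
        (gaussianProd (ε • (fromBlocks F (-crossMatrix ε S) (-(crossMatrix ε S)ᵀ) G)⁻¹)) : EReal)
      = dualObjective ε A B S F G := by
  have hdens := gaussianProd_eq_withDensity hS (hQ.inv.smul hε)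
  have hkl : klDiv (gaussianProd
      (ε • (fromBlocks F (-crossMatrix ε S) (-(crossMatrix ε S)ᵀ) G)⁻¹)) (gaussianProd S) ≠ ∞ := by
    have hint := integrable_logDensity hπ S
      (ε • (fromBlocks F (-crossMatrix ε S) (-(crossMatrix ε S)ᵀ) G)⁻¹)
    have hprob := hdens ▸ (inferInstance : IsProbabilityMeasure (gaussianProd
      (ε • (fromBlocks F (-crossMatrix ε S) (-(crossMatrix ε S)ᵀ) G)⁻¹)))
    rw [hdens] at hint ⊢
    exact klDiv_withDensity_exp_ne_top (measurable_logDensity _ _) hprob hint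
  have hgap := integral_cost_add_klDiv hA hB hS hε hQ hπ hkl
  rw [klDiv_self, ENNReal.toReal_zero, mul_zero, add_zero] at hgap
  rw [objective_eq_ofReal hε hπ hkl, hgap, dualObjective_eq_dualReal hS hε hQ,
    EReal.coe_ennreal_ofReal, max_eq_left]
  -- The dual value is nonnegative here because it equals a primal cost.
  rw [← hgap]
  exact add_nonneg (integral_nonneg fun p ↦ by positivity) (by positivity)

/-- If P has off-diagonal block -ε⁻¹M_ε and P⁻¹ has diagonal blocks A and B, then Q = εP has
off-diagonal block -M_ε and εQ⁻¹ = P⁻¹. -/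
lemma exists_optimal_dual (hA : A.PosDef) (hB : B.PosDef)
    (S : Matrix (Fin d ⊕ Fin d) (Fin d ⊕ Fin d) ℝ) {ε : ℝ} (hε : 0 < ε) :
    ∃ F G : Matrix (Fin d) (Fin d) ℝ, F.PosDef ∧ G.PosDef ∧
      (fromBlocks F (-crossMatrix ε S) (-(crossMatrix ε S)ᵀ) G).PosDef ∧
      gaussianProd (ε • (fromBlocks F (-crossMatrix ε S) (-(crossMatrix ε S)ᵀ) G)⁻¹)
        ∈ couplings (gaussian A) (gaussian B) := by
  obtain ⟨F, G, hF, hG, hP, h1, h2⟩ :=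
    exists_posDef_fromBlocks_inv hA hB (ε⁻¹ • crossMatrix ε S)
  set P := fromBlocks F (-(ε⁻¹ • crossMatrix ε S)) (-(ε⁻¹ • crossMatrix ε S)ᵀ) G
  have hQ : fromBlocks (ε • F) (-crossMatrix ε S) (-(crossMatrix ε S)ᵀ) (ε • G) = ε • P := by
    rw [fromBlocks_smul, transpose_smul, smul_neg, smul_neg, smul_smul, smul_smul,
      mul_inv_cancel₀ hε.ne', one_smul, one_smul]
  have hinv : ε • (ε • P)⁻¹ = P⁻¹ := by
    have : (ε • P)⁻¹ = ε⁻¹ • P⁻¹ := by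
      refine inv_eq_left_inv ?_
      rw [smul_mul_smul_comm, nonsing_inv_mul _ hP.det_pos.ne'.isUnit, inv_mul_cancel₀ hε.ne',
        one_smul]
    rw [this, smul_smul, mul_inv_cancel₀ hε.ne', one_smul]
  refine ⟨ε • F, ε • G, hF.smul hε, hG.smul hε, hQ ▸ hP.smul hε, ?_⟩
  rw [hQ, hinv]
  have := gaussianProd_mem_couplings hP.inv
  rwa [h1, h2] at this

end Couplings

end GaussianEOT

theorem mainTheorem3 (d : ℕ) (ε : ℝ) (hε : 0 < ε)
    (A B : Matrix (Fin d) (Fin d) ℝ) (hA : A.PosDef) (hB : B.PosDef)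
    (S : Matrix (Fin d ⊕ Fin d) (Fin d ⊕ Fin d) ℝ) (hS : S.PosDef) :
    IsGreatest
      {v : EReal | ∃ F G : Matrix (Fin d) (Fin d) ℝ, F.PosDef ∧ G.PosDef ∧
        v = GaussianEOT.dualObjective ε A B S F G}
      ((GaussianEOT.value ε (GaussianEOT.gaussianProd S)
        (GaussianEOT.gaussian A) (GaussianEOT.gaussian B) : ENNReal) : EReal) := by
  have weak : ∀ F G, GaussianEOT.dualObjective ε A B S F G ≤
      ((GaussianEOT.value ε (GaussianEOT.gaussianProd S)
        (GaussianEOT.gaussian A) (GaussianEOT.gaussian B) : ENNReal) : EReal) := by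
    intro F G
    -- The infimum is taken in `ℝ≥0∞` while the dual objective may be negative or `⊥`. Truncating it
    -- at 0 allows the comparison there and only increases it.
    have h : (GaussianEOT.dualObjective ε A B S F G).toENNReal ≤ GaussianEOT.value ε
        (GaussianEOT.gaussianProd S) (GaussianEOT.gaussian A) (GaussianEOT.gaussian B) := by
      refine le_iInf₂ fun π hπ ↦ ?_
      have := EReal.toENNReal_le_toENNReal
        (GaussianEOT.dualObjective_le_objective hA hB hS hε F G hπ)
      rwa [EReal.toENNReal_coe] at this
    refine le_trans ?_ (EReal.coe_ennreal_le_coe_ennreal_iff.2 h)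
    rw [EReal.coe_toENNReal_eq_max]
    exact le_max_right _ _
  refine ⟨?_, ?_⟩
  · obtain ⟨F, G, hF, hG, hQ, hπ⟩ := GaussianEOT.exists_optimal_dual hA hB S hε
    refine ⟨F, G, hF, hG, le_antisymm ?_ (weak F G)⟩
    rw [← GaussianEOT.objective_gaussianProd hA hB hS hε hQ hπ, EReal.coe_ennreal_le_coe_ennreal_iff]
    exact iInf₂_le _ hπ
  · rintro v ⟨F, G, -, -, rfl⟩
    exact weak F G
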